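/- Let $x_1,\dots,x_N\in\mathbb{R}^n$, $\sigma>0$, and put $W_{ij}=\exp(-\|x_i-x_j\|_2^2/(2\sigma))$, $D=\mathrm{diag}(\sum_{l} W_{il})$, $A=D^{-1/2}WD^{-1/2}$. Let $\Phi$ be a random $m\times n$ matrix with independent $\mathcal N(0,1)$ entries, and let $\tilde A$ be the affinity matrix built in the same way (with the same $\sigma$) from the compressed points $\tilde x_i=\frac1{\sqrt m}\Phi x_i\in\mathbb{R}^m$. Let $\lambda_1\ge\dots\ge\lambda_N$ be the eigenvalues of $A$, let $1\le k<N$, and let $V_k$ (resp. $\tilde V_k$) be the $N\times k$ matrix whose columns are the first $k$ vectors of an orthonormal basis of eigenvectors of $A$ (resp. $\tilde A$), ordered by decreasing eigenvalue; $v(i)$ and $\tilde v(i)$ denote their $i$-th rows. **Theorem.** For every $K>0$ there is $c>0$ such that for every $\eta\in(0,1)$ there is $C>0$ with the following property. Let $1\le r\le n$, $0<\varepsilon<1$, $\alpha>0$, and suppose that the $x_i$ are $r$-sparse (or, more generally, that for some orthogonal $n\times n$ matrix $B$ every $Bx_i$ has at most $r$ nonzero entries), that $\max_{i,j}\|x_i-x_j\|_2^2/(2\sigma)\le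 K$, that $\lambda_k-\lambda_{k+1}\ge\alpha$ and $\lambda_k\ge\alpha$, and that the number of measurements satisfies $$m\ \ge\ C\,\frac{r}{\varepsilon^2}\log\frac{n}{\varepsilon^2 r}.$$ Then for every choice of $V_k$, with probability at least $1-\min(\eta,e^{-c\varepsilon^2m})$, for every choice of $\tilde V_k$, for every orthogonal $k\times k$ matrix $Q$ that minimizes $\|\tilde V_k-V_kQ\|_F$ among orthogonal matrices, and for every $i=1,\dots,N$, $$\|\tilde v(i)-v(i)Q\|_2\ \le\ (1+\sqrt2)\,\frac{N\varepsilon}{\alpha}.$$ (The exceptional set has outer probability at most $\min(\eta,e^{-c\varepsilon^2m})$.) -/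

import Mathlib

open MeasureTheory ProbabilityTheory
open scoped Matrix

namespace CompressedSpectral

noncomputable section

/-- Gaussian edge weights `W i j = exp (-‖x i - x j‖₂² / (2σ))` of a family of `N` points. -/
def weight {N d : ℕ} (σ : ℝ) (x : Fin N → EuclideanSpace ℝ (Fin d)) :
    Matrix (Fin N) (Fin N) ℝ :=
  Matrix.of fun i j => Real.exp (-(‖x i - x j‖ ^ 2 / (2 * σ)))

/-- Row sums `D i i = ∑ k, W i k`. -/
def degree {N d : ℕ} (σ : ℝ) (x : Fin N → EuclideanSpace ℝ (Fin d)) (i : Fin N) : ℝ :=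
  ∑ k, weight σ x i k

/-- The affinity matrix `A = D^{-1/2} W D^{-1/2}`. -/
def affinity {N d : ℕ} (σ : ℝ) (x : Fin N → EuclideanSpace ℝ (Fin d)) :
    Matrix (Fin N) (Fin N) ℝ :=
  Matrix.diagonal (fun i => (Real.sqrt (degree σ x i))⁻¹) * weight σ x *
    Matrix.diagonal (fun i => (Real.sqrt (degree σ x i))⁻¹)

/-- The compressed data points `m^{-1/2} Φ x i`. -/
def compress {N n m : ℕ} (Φ : Matrix (Fin m) (Fin n) ℝ)
    (x : Fin N → EuclideanSpace ℝ (Fin n)) (i : Fin N) : EuclideanSpace ℝ (Fin m) :=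
  WithLp.toLp 2 ((Real.sqrt (m : ℝ))⁻¹ • (Φ *ᵥ (x i).ofLp))

/-- The law of an `m × n` matrix with independent standard normal entries (as a family
of rows). -/
def gaussianMatrix (m n : ℕ) : Measure (Fin m → Fin n → ℝ) :=
  Measure.pi fun _ : Fin m => Measure.pi fun _ : Fin n => gaussianReal 0 1

/-- `x` has at most `r` nonzero coordinates. -/
def IsSparse {n : ℕ} (r : ℕ) (x : Fin n → ℝ) : Prop :=
  {l | x l ≠ 0}.ncard ≤ r

/-- `A = V diag(lam) Vᵀ` with `V` orthogonal and the eigenvalues in decreasing order: the columns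
of `V` are orthonormal eigenvectors of `A` for its ordered eigenvalues, with multiplicity. -/
structure IsOrderedEigendecomposition {N : ℕ} (A : Matrix (Fin N) (Fin N) ℝ)
    (lam : Fin N → ℝ) (V : Matrix (Fin N) (Fin N) ℝ) : Prop where
  antitone : Antitone lam
  orthogonal : V ∈ Matrix.orthogonalGroup (Fin N) ℝ
  eigen : A * V = V * Matrix.diagonal lam

/-- The matrix formed by the first `k` columns of `V`. -/
def firstCols {N k : ℕ} (h : k ≤ N) (V : Matrix (Fin N) (Fin N) ℝ) :
    Matrix (Fin N) (Fin k) ℝ :=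
  V.submatrix id (Fin.castLE h)

section
open scoped Matrix.Norms.Frobenius

/-- `Q` is an orthogonal matrix that minimizes the Frobenius norm `‖V' - V Q‖_F` among
orthogonal matrices. -/
def IsBestRotation {N k : ℕ} (V V' : Matrix (Fin N) (Fin k) ℝ)
    (Q : Matrix (Fin k) (Fin k) ℝ) : Prop :=
  Q ∈ Matrix.orthogonalGroup (Fin k) ℝ ∧
    ∀ R ∈ Matrix.orthogonalGroup (Fin k) ℝ, ‖V' - V * Q‖ ≤ ‖V' - V * R‖

end

end

end CompressedSpectral

/-!
The entries of the affinity matrix `A` depend on the points only through their mutual squared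
distances `‖x i - x j‖ ^ 2 / (2 σ) ≤ K`. All weights are therefore at least `e^{-K}`, all degrees at
least `N e^{-K}`, and all entries of `A` at most `e^K / N`. If a compression keeps every squared
distance up to a relative error `δ`, each entry of `A` changes by a factor between `e^{-2 δ K}` and
`e^{2 δ K}`, so that the Frobenius norm of `A - A'` is `O(δ)`, whatever `N` is
(`trace_affinity_sub_le`).

Leading eigenvectors are stable under such a perturbation. By Ky Fan's principle, the first `k`
eigenvectors of `A` maximize `tr (Yᵀ A Y)` among `k`-frames `Y`, and beat any other frame by at
least the spectral gap times `‖sin Θ‖²`, where `Θ` are the principal angles. Applying this to `A`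
and to `A'` gives `‖sin Θ‖ ≤ √2 ‖A - A'‖ / α` (`gap_sq_mul_sin_sq_le`), and the polar factor of the
overlap matrix of the two frames is a rotation that takes one to within `√2 ‖sin Θ‖` of the other
(`exists_orthogonal_trace_sub_le`). The best rotation does at least as well, and each row is bounded
by the Frobenius norm.

The target `(1 + √2) N ε / α` is at least `2`, hence trivial, unless `N ε < α`, and `α ≤ 1` since
the eigenvalues of `A` do not exceed `1`. In the remaining case a distortion `δ` proportional to
`N ε` may be allowed. For one pair of points the distortion exceeds `δ` with probability at most
`2 exp (-δ² m / 8)`, by a Chernoff bound for the chi-squared distribution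
(`gaussianMatrix_distortion_le`). Because `δ² m` is of the order of `N² ε² m`, the union bound over
the `N²` pairs is absorbed as soon as `ε² m` exceeds a constant (`sq_mul_two_mul_exp_le`), and this
follows from the lower bound on `m`: here `ε ≤ 1/2`, so `ε² m ≥ C r log (n / (ε² r)) ≥ C`.
-/

namespace CompressedSpectral

/-! ### Concentration of the squared length of a compressed vector -/

/-- A unit-length combination of independent standard normal variables is standard normal. -/
lemma map_sum_mul_pi_gaussianReal {n : ℕ} {u : Fin n → ℝ} (hu : ∑ l, u l ^ 2 = 1) :
    (Measure.pi fun _ : Fin n => gaussianReal 0 1).map (fun g => ∑ l, g l * u l)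
      = gaussianReal 0 1 := by
  have hmeas : Measurable fun g : Fin n → ℝ => ∑ l, g l * u l := by fun_prop
  have := Measure.isProbabilityMeasure_map
    (μ := Measure.pi fun _ : Fin n => gaussianReal 0 1) hmeas.aemeasurable
  refine Measure.ext_of_charFun (funext fun t => ?_)
  have hfactor : ∀ l, ∫ g, Complex.exp ((t * u l : ℝ) * g * Complex.I) ∂gaussianReal 0 1
      = Complex.exp (-((t * u l) ^ 2 / 2 : ℝ)) := by
    intro l
    rw [← charFun_apply_real, charFun_gaussianReal]
    congr 1
    push_cast
    ring
  rw [charFun_apply_real, integral_map hmeas.aemeasurable (by fun_prop)]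
  calc ∫ g : Fin n → ℝ, Complex.exp (t * (∑ l, g l * u l : ℝ) * Complex.I)
        ∂(Measure.pi fun _ : Fin n => gaussianReal 0 1)
      = ∫ g : Fin n → ℝ, ∏ l, Complex.exp ((t * u l : ℝ) * g l * Complex.I)
        ∂(Measure.pi fun _ : Fin n => gaussianReal 0 1) := by
        congr 1
        funext g
        rw [← Complex.exp_sum]
        congr 1
        push_cast
        rw [Finset.mul_sum, Finset.sum_mul]
        exact Finset.sum_congr rfl fun l _ => by ring
    _ = ∏ l, ∫ g, Complex.exp ((t * u l : ℝ) * g * Complex.I) ∂gaussianReal 0 1 :=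
        integral_fintype_prod_eq_prod
          (fun l (g : ℝ) => Complex.exp ((t * u l : ℝ) * g * Complex.I))
    _ = Complex.exp (-(t ^ 2 / 2 : ℝ)) := by
        simp_rw [hfactor]
        rw [← Complex.exp_sum]
        congr 1
        norm_cast
        rw [Finset.sum_neg_distrib, ← Finset.sum_div]
        simp_rw [mul_pow]
        rw [← Finset.mul_sum, hu, mul_one]
    _ = charFun (gaussianReal 0 1) t := by
        rw [charFun_gaussianReal]
        congr 1
        push_cast
        ring

lemma one_le_one_sub_mul_exp {u : ℝ} (ht : u ≤ 1 / 2) :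
    1 ≤ (1 - u) * Real.exp (u + u ^ 2) := by
  rcases le_total 0 u with h | h
  · have := Real.quadratic_le_exp_of_nonneg (x := u + u ^ 2) (by positivity)
    have h3 : 1 ≤ (1 - u) * (1 + (u + u ^ 2) + (u + u ^ 2) ^ 2 / 2) := by
      have : 0 ≤ u ^ 2 * (1 - u - u ^ 2 - u ^ 3) := by
        apply mul_nonneg (sq_nonneg _)
        nlinarith [mul_nonneg h h, mul_nonneg (mul_nonneg h h) (sub_nonneg.2 ht)]
      nlinarith
    exact h3.trans (mul_le_mul_of_nonneg_left this (by linarith))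
  · have h3 : 1 ≤ (1 - u) * (u + u ^ 2 + 1) := by
      nlinarith [mul_nonneg (neg_nonneg.2 h) (sq_nonneg u)]
    exact h3.trans (mul_le_mul_of_nonneg_left (Real.add_one_le_exp _) (by linarith))

lemma integrable_exp_mul_sq_gaussianReal {t : ℝ} (ht : t ≤ 1 / 4) :
    Integrable (fun x : ℝ => Real.exp (t * x ^ 2)) (gaussianReal 0 1) := by
  rw [gaussianReal_of_var_ne_zero 0 one_ne_zero,
    integrable_withDensity_iff_integrable_smul' (measurable_gaussianPDF 0 1)
      (Filter.Eventually.of_forall fun _ => gaussianPDF_lt_top)]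
  have := ((integrable_exp_neg_mul_sq (b := 1 / 2 - t) (by linarith)).const_mul
    (√(2 * Real.pi))⁻¹)
  refine this.congr (Filter.Eventually.of_forall fun x => ?_)
  simp only [toReal_gaussianPDF, gaussianPDFReal, smul_eq_mul, NNReal.coe_one, mul_one, sub_zero]
  rw [mul_assoc, ← Real.exp_add]
  congr 2
  ring

/-- The moment generating function `(1 - 2 t) ^ (-1/2)` of a squared standard normal variable is
at most that of a normal variable of mean `1` and variance `4`, as long as `t ≤ 1/4`. -/
lemma integral_exp_mul_sq_gaussianReal_le {t : ℝ} (ht : t ≤ 1 / 4) :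
    ∫ x, Real.exp (t * x ^ 2) ∂gaussianReal 0 1 ≤ Real.exp (t + 2 * t ^ 2) := by
  rw [integral_gaussianReal_eq_integral_smul one_ne_zero]
  have heq : ∀ x : ℝ, gaussianPDFReal 0 1 x • Real.exp (t * x ^ 2)
      = (√(2 * Real.pi))⁻¹ * Real.exp (-(1 / 2 - t) * x ^ 2) := by
    intro x
    simp only [gaussianPDFReal, smul_eq_mul, NNReal.coe_one, mul_one, sub_zero]
    rw [mul_assoc, ← Real.exp_add]
    congr 2
    ring
  simp_rw [heq]
  rw [integral_const_mul, integral_gaussian, ← Real.sqrt_inv, ← Real.sqrt_mul (by positivity)]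
  have hpos : 0 < 1 - 2 * t := by linarith
  have hval : (2 * Real.pi)⁻¹ * (Real.pi / (1 / 2 - t)) = (1 - 2 * t)⁻¹ := by
    have := Real.pi_pos
    have h4 : (1 / 2 - t) ≠ 0 := by linarith
    field_simp
  rw [hval, Real.sqrt_le_left (Real.exp_pos _).le, ← Real.exp_nat_mul, inv_le_iff_one_le_mul₀ hpos]
  have hexp : ((2 : ℕ) : ℝ) * (t + 2 * t ^ 2) = 2 * t + (2 * t) ^ 2 := by
    push_cast
    ring
  rw [hexp, mul_comm]
  exact one_le_one_sub_mul_exp (by linarith)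

/-- Chernoff bound in either direction, according to the sign of `t`. -/
lemma gaussianMatrix_exp_tail_le {m n : ℕ} {u : Fin n → ℝ} (hu : ∑ l, u l ^ 2 = 1) {t : ℝ}
    (ht : t ≤ 1 / 4) (s : ℝ) :
    (gaussianMatrix m n).real {Φ | s ≤ t * ∑ a, (∑ l, Φ a l * u l) ^ 2}
      ≤ Real.exp (m * (t + 2 * t ^ 2) - s) := by
  set μ := Measure.pi fun _ : Fin n => gaussianReal 0 1 with hμ
  have hmeas : Measurable fun g : Fin n → ℝ => ∑ l, g l * u l := by fun_prop
  have hlaw := map_sum_mul_pi_gaussianReal hu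
  have hint : Integrable (fun g : Fin n → ℝ => Real.exp (t * (∑ l, g l * u l) ^ 2)) μ := by
    have h := integrable_exp_mul_sq_gaussianReal ht
    rw [← hlaw, integrable_map_measure (by fun_prop) hmeas.aemeasurable] at h
    exact h
  have hle : ∫ g : Fin n → ℝ, Real.exp (t * (∑ l, g l * u l) ^ 2) ∂μ
      ≤ Real.exp (t + 2 * t ^ 2) := by
    have h := integral_exp_mul_sq_gaussianReal_le ht
    rw [← hlaw, integral_map hmeas.aemeasurable (by fun_prop)] at h
    exact h
  have : IsProbabilityMeasure (gaussianMatrix m n) := by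
    unfold gaussianMatrix; infer_instance
  have hexp : ∀ Φ : Fin m → Fin n → ℝ, Real.exp (1 * (t * ∑ a, (∑ l, Φ a l * u l) ^ 2))
      = ∏ a, Real.exp (t * (∑ l, Φ a l * u l) ^ 2) := by
    intro Φ
    rw [← Real.exp_sum, one_mul, Finset.mul_sum]
  have hmgf : mgf (fun Φ : Fin m → Fin n → ℝ => t * ∑ a, (∑ l, Φ a l * u l) ^ 2)
      (gaussianMatrix m n) 1 ≤ Real.exp (m * (t + 2 * t ^ 2)) := by
    unfold mgf gaussianMatrix
    simp_rw [hexp]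
    rw [integral_fintype_prod_eq_prod
      (f := fun (_ : Fin m) (g : Fin n → ℝ) => Real.exp (t * (∑ l, g l * u l) ^ 2)),
      Finset.prod_const, Finset.card_univ, Fintype.card_fin, Real.exp_nat_mul]
    exact pow_le_pow_left₀ (integral_nonneg fun _ => (Real.exp_pos _).le) hle m
  have hchern := measure_ge_le_exp_mul_mgf (μ := gaussianMatrix m n)
    (X := fun Φ : Fin m → Fin n → ℝ => t * ∑ a, (∑ l, Φ a l * u l) ^ 2) (t := 1) s zero_le_one
    (by
      simp_rw [hexp]
      exact Integrable.fintype_prod fun _ => hint)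
  refine hchern.trans ((mul_le_mul_of_nonneg_left hmgf (Real.exp_pos _).le).trans ?_)
  rw [← Real.exp_add]
  exact Real.exp_le_exp.2 (by linarith)

lemma gaussianMatrix_abs_tail_le_of_unit {m n : ℕ} {u : Fin n → ℝ} (hu : ∑ l, u l ^ 2 = 1)
    {δ : ℝ} (hδ : 0 ≤ δ) (hδ1 : δ ≤ 1) :
    (gaussianMatrix m n).real {Φ | δ * m ≤ |∑ a, (∑ l, Φ a l * u l) ^ 2 - m|}
      ≤ 2 * Real.exp (-(δ ^ 2 * m / 8)) := by
  have : IsProbabilityMeasure (gaussianMatrix m n) := by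
    unfold gaussianMatrix; infer_instance
  -- The exponent `-t δ + 2 t ^ 2` of the Chernoff bound is least at `t = δ / 4`.
  have hup := gaussianMatrix_exp_tail_le (m := m) hu (t := δ / 4) (by linarith)
    (δ / 4 * ((1 + δ) * m))
  have hlow := gaussianMatrix_exp_tail_le (m := m) hu (t := -(δ / 4)) (by linarith)
    (-(δ / 4) * ((1 - δ) * m))
  have he1 : (m : ℝ) * (δ / 4 + 2 * (δ / 4) ^ 2) - δ / 4 * ((1 + δ) * m) = -(δ ^ 2 * m / 8) := by
    ring
  have he2 : (m : ℝ) * (-(δ / 4) + 2 * (-(δ / 4)) ^ 2) - -(δ / 4) * ((1 - δ) * m)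
      = -(δ ^ 2 * m / 8) := by ring
  rw [he1] at hup
  rw [he2] at hlow
  rw [two_mul]
  refine le_trans ?_ (add_le_add hup hlow)
  refine le_trans (measureReal_mono ?_ (measure_ne_top _ _)) (measureReal_union_le _ _)
  intro Φ hΦ
  simp only [Set.mem_ofPred_eq, Set.mem_union] at hΦ ⊢
  rcases le_abs.1 hΦ with h | h
  · left
    exact mul_le_mul_of_nonneg_left (by linarith) (by linarith)
  · right
    exact mul_le_mul_of_nonpos_left (by linarith) (by linarith)

/-- `m^{-1/2} Φ` distorts the squared distance of two given points by a factor outside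
`[1 - δ, 1 + δ]` only with exponentially small probability. -/
lemma gaussianMatrix_distortion_le {N m n : ℕ} (hm : 0 < m)
    (x : Fin N → EuclideanSpace ℝ (Fin n)) (i j : Fin N) {δ : ℝ} (hδ : 0 ≤ δ) (hδ1 : δ ≤ 1) :
    gaussianMatrix m n {Φ | δ * ‖x i - x j‖ ^ 2 <
        |‖compress (Matrix.of Φ) x i - compress (Matrix.of Φ) x j‖ ^ 2 - ‖x i - x j‖ ^ 2|}
      ≤ ENNReal.ofReal (2 * Real.exp (-(δ ^ 2 * m / 8))) := by
  have : IsProbabilityMeasure (gaussianMatrix m n) := by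
    unfold gaussianMatrix; infer_instance
  have hm' : (0 : ℝ) < m := by exact_mod_cast hm
  set ρ := ‖x i - x j‖ with hρ
  have hnorm : ∀ Φ : Fin m → Fin n → ℝ,
      ‖compress (Matrix.of Φ) x i - compress (Matrix.of Φ) x j‖ ^ 2
        = (∑ a, (∑ l, Φ a l * (x i - x j) l) ^ 2) / m := by
    intro Φ
    rw [EuclideanSpace.real_norm_sq_eq, Finset.sum_div]
    refine Finset.sum_congr rfl fun a _ => ?_
    have : (compress (Matrix.of Φ) x i - compress (Matrix.of Φ) x j) a
        = (√(m : ℝ))⁻¹ * ∑ l, Φ a l * (x i - x j) l := by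
      simp [compress, Matrix.mulVec, dotProduct, mul_sub, Finset.sum_sub_distrib]
    rw [this, mul_pow, inv_pow, Real.sq_sqrt hm'.le, div_eq_inv_mul]
  rcases eq_or_ne (x i - x j) 0 with h0 | h0
  · have hempty : {Φ : Fin m → Fin n → ℝ | δ * ρ ^ 2 <
        |‖compress (Matrix.of Φ) x i - compress (Matrix.of Φ) x j‖ ^ 2 - ρ ^ 2|} = ∅ := by
      ext Φ
      simp [hnorm, hρ, h0]
    rw [hempty]
    simp
  have hρ0 : 0 < ρ := norm_pos_iff.2 h0
  have hsq : ∑ l, (x i - x j) l ^ 2 = ρ ^ 2 := (EuclideanSpace.real_norm_sq_eq _).symm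
  have hu : ∑ l, ((x i - x j) l / ρ) ^ 2 = 1 := by
    simp_rw [div_pow]
    rw [← Finset.sum_div, hsq, div_self (by positivity)]
  rw [← ofReal_measureReal]
  refine ENNReal.ofReal_le_ofReal (le_trans (measureReal_mono ?_ (measure_ne_top _ _))
    (gaussianMatrix_abs_tail_le_of_unit hu hδ hδ1))
  intro Φ hΦ
  simp only [Set.mem_ofPred_eq, hnorm] at hΦ ⊢
  have hS : ∑ a, (∑ l, Φ a l * ((x i - x j) l / ρ)) ^ 2
      = (∑ a, (∑ l, Φ a l * (x i - x j) l) ^ 2) / ρ ^ 2 := by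
    rw [Finset.sum_div]
    refine Finset.sum_congr rfl fun a _ => ?_
    rw [← div_pow, Finset.sum_div]
    simp_rw [mul_div_assoc]
  rw [hS]
  set S := ∑ a, (∑ l, Φ a l * (x i - x j) l) ^ 2
  have hS2 : S / ρ ^ 2 - m = (m / ρ ^ 2) * (S / m - ρ ^ 2) := by field_simp
  rw [hS2, abs_mul, abs_of_pos (by positivity)]
  calc δ * m = (m / ρ ^ 2) * (δ * ρ ^ 2) := by field_simp
    _ ≤ _ := mul_le_mul_of_nonneg_left hΦ.le (by positivity)

/-! ### Rotating one orthonormal frame onto another -/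

lemma trace_transpose_mul_eq_sum {ι κ : Type*} [Fintype ι] [Fintype κ] (A B : Matrix ι κ ℝ) :
    (Aᵀ * B).trace = ∑ i, ∑ j, A i j * B i j := by
  simp only [Matrix.trace, Matrix.diag, Matrix.mul_apply, Matrix.transpose_apply]
  exact Finset.sum_comm

lemma trace_transpose_mul_self_eq_sum {ι κ : Type*} [Fintype ι] [Fintype κ] (A : Matrix ι κ ℝ) :
    (Aᵀ * A).trace = ∑ i, ∑ j, A i j ^ 2 := by
  simp_rw [trace_transpose_mul_eq_sum, sq]

lemma trace_transpose_mul_sq_le {ι κ : Type*} [Fintype ι] [Fintype κ] (A B : Matrix ι κ ℝ) :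
    (Aᵀ * B).trace ^ 2 ≤ (Aᵀ * A).trace * (Bᵀ * B).trace := by
  rw [trace_transpose_mul_eq_sum, trace_transpose_mul_self_eq_sum,
    trace_transpose_mul_self_eq_sum, ← Fintype.sum_prod_type', ← Fintype.sum_prod_type',
    ← Fintype.sum_prod_type']
  exact Finset.sum_mul_sq_le_sq_mul_sq _ _ _

/-- With `M = Xᵀ Y`, the number `k - ‖M‖²_F` is the squared norm of the sines of the principal
angles between the ranges of `X` and `Y`. When it is less than `1`, no angle is right, so that `M`
is invertible and has the orthogonal polar factor `R = M (Mᵀ M)^{-1/2}`. The singular values of `M`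
lie in `[0, 1]`, so `tr (Mᵀ R)`, their sum, is at least the sum `‖M‖²_F` of their squares. -/
lemma exists_orthogonal_trace_sub_le {ι κ : Type*} [Fintype ι] [Fintype κ] [DecidableEq κ]
    {X Y : Matrix ι κ ℝ} (hX : Xᵀ * X = 1) (hY : Yᵀ * Y = 1)
    (hlt : Fintype.card κ - ((Xᵀ * Y)ᵀ * (Xᵀ * Y)).trace < 1) :
    ∃ R ∈ Matrix.orthogonalGroup κ ℝ, ((Y - X * R)ᵀ * (Y - X * R)).trace
      ≤ 2 * (Fintype.card κ - ((Xᵀ * Y)ᵀ * (Xᵀ * Y)).trace) := by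
  set M := Xᵀ * Y with hM
  have hH : (Mᵀ * M).IsHermitian := by
    simp [Matrix.IsHermitian, Matrix.conjTranspose_eq_transpose_of_trivial, Matrix.transpose_mul]
  obtain ⟨O, μ, hOO, hOO', hdiag⟩ : ∃ (O : Matrix κ κ ℝ) (μ : κ → ℝ), Oᵀ * O = 1 ∧ O * Oᵀ = 1 ∧
      Oᵀ * (Mᵀ * M) * O = Matrix.diagonal μ := by
    refine ⟨hH.eigenvectorUnitary, hH.eigenvalues, ?_, ?_, ?_⟩
    · exact Unitary.coe_star_mul_self hH.eigenvectorUnitary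
    · exact Unitary.coe_mul_star_self hH.eigenvectorUnitary
    · have h := hH.conjStarAlgAut_star_eigenvectorUnitary
      rw [Unitary.conjStarAlgAut_star_apply] at h
      exact h
  have hnonneg : ∀ B : Matrix ι κ ℝ, ∀ i, 0 ≤ (Bᵀ * B) i i := by
    intro B i
    simp only [Matrix.mul_apply, Matrix.transpose_apply]
    exact Finset.sum_nonneg fun _ _ => mul_self_nonneg _
  -- `1 - diag μ` is the Gram matrix of the columns of `Y O` projected off the range of `X`.
  have hμ1 : ∀ i, μ i ≤ 1 := by
    intro i
    have hgram : (Y * O - X * (M * O))ᵀ * (Y * O - X * (M * O)) = 1 - Matrix.diagonal μ := by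
      have h1 : (Y * O)ᵀ * (Y * O) = 1 := by
        rw [Matrix.transpose_mul, Matrix.mul_assoc, ← Matrix.mul_assoc Yᵀ, hY, Matrix.one_mul, hOO]
      have h2 : (X * (M * O))ᵀ * (X * (M * O)) = Matrix.diagonal μ := by
        rw [Matrix.transpose_mul, Matrix.mul_assoc, ← Matrix.mul_assoc Xᵀ, hX, Matrix.one_mul,
          Matrix.transpose_mul, ← hdiag]
        simp only [Matrix.mul_assoc]
      have h3 : (X * (M * O))ᵀ * (Y * O) = Matrix.diagonal μ := by
        rw [Matrix.transpose_mul, Matrix.mul_assoc, ← Matrix.mul_assoc Xᵀ, ← hM,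
          Matrix.transpose_mul, ← hdiag]
        simp only [Matrix.mul_assoc]
      have h4 : (Y * O)ᵀ * (X * (M * O)) = Matrix.diagonal μ := by
        have := congrArg Matrix.transpose h3
        rwa [Matrix.transpose_mul, Matrix.transpose_transpose, Matrix.diagonal_transpose] at this
      rw [Matrix.transpose_sub, Matrix.sub_mul, Matrix.mul_sub, Matrix.mul_sub, h1, h2, h3, h4]
      simp
    have := hnonneg (Y * O - X * (M * O)) i
    rw [hgram] at this
    simpa using this
  have htrace : (Mᵀ * M).trace = ∑ i, μ i := by
    rw [← Matrix.trace_diagonal, ← hdiag, Matrix.trace_mul_comm _ O, ← Matrix.mul_assoc O, hOO',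
      Matrix.one_mul]
  have hμ0 : ∀ i, 0 < μ i := by
    intro i
    have h1 : ∑ j, (1 - μ j) < 1 := by
      rw [Finset.sum_sub_distrib, ← htrace]
      simpa using hlt
    have h2 := Finset.single_le_sum (f := fun j => 1 - μ j)
      (fun j _ => sub_nonneg.2 (hμ1 j)) (Finset.mem_univ i)
    linarith
  set D := Matrix.diagonal fun i => (√(μ i))⁻¹ with hD
  have hsqrt : ∀ i, √(μ i) * √(μ i) = μ i := fun i => Real.mul_self_sqrt (hμ0 i).le
  have hsqrt0 : ∀ i, 0 < √(μ i) := fun i => Real.sqrt_pos.2 (hμ0 i)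
  set R := M * O * D * Oᵀ with hR
  have hRR : Rᵀ * R = 1 := by
    have hmid : D * (Oᵀ * (Mᵀ * M) * O) * D = 1 := by
      rw [hdiag, hD, Matrix.diagonal_mul_diagonal, Matrix.diagonal_mul_diagonal,
        ← Matrix.diagonal_one]
      congr 1
      funext i
      have := (hsqrt0 i).ne'
      nth_rewrite 2 [← hsqrt i]
      field_simp
    calc (M * O * D * Oᵀ)ᵀ * (M * O * D * Oᵀ)
        = O * (D * (Oᵀ * (Mᵀ * M) * O) * D) * Oᵀ := by
          simp only [Matrix.transpose_mul, Matrix.transpose_transpose, hD,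
            Matrix.diagonal_transpose, Matrix.mul_assoc]
      _ = 1 := by rw [hmid, Matrix.mul_one, hOO']
  refine ⟨R, (Matrix.mem_orthogonalGroup_iff' _ _).2 hRR, ?_⟩
  have hMR : (Mᵀ * R).trace = ∑ i, √(μ i) := by
    have h1 : (Mᵀ * R).trace = (Oᵀ * (Mᵀ * M) * O * D).trace := by
      rw [hR, ← Matrix.mul_assoc, Matrix.trace_mul_comm]
      simp only [Matrix.mul_assoc]
    rw [h1, hdiag, hD, Matrix.diagonal_mul_diagonal, Matrix.trace_diagonal]
    refine Finset.sum_congr rfl fun i _ => ?_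
    have := (hsqrt0 i).ne'
    nth_rewrite 1 [← hsqrt i]
    field_simp
  have hexpand : ((Y - X * R)ᵀ * (Y - X * R)).trace
      = 2 * (Fintype.card κ - (Mᵀ * R).trace) := by
    have h1 : (X * R)ᵀ * (X * R) = 1 := by
      rw [Matrix.transpose_mul, Matrix.mul_assoc, ← Matrix.mul_assoc Xᵀ, hX, Matrix.one_mul, hRR]
    have h2 : Yᵀ * (X * R) = Mᵀ * R := by
      rw [hM, Matrix.transpose_mul, Matrix.transpose_transpose, Matrix.mul_assoc]
    have h3 : ((X * R)ᵀ * Y).trace = (Mᵀ * R).trace := by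
      rw [← h2, ← Matrix.trace_transpose, Matrix.transpose_mul, Matrix.transpose_transpose]
    rw [Matrix.transpose_sub, Matrix.sub_mul, Matrix.mul_sub, Matrix.mul_sub, hY, h1, h2]
    simp only [Matrix.trace_sub, h3, Matrix.trace_one]
    ring
  rw [hexpand, hMR, htrace]
  have : ∑ i, μ i ≤ ∑ i, √(μ i) := by
    refine Finset.sum_le_sum fun i _ => ?_
    have h1 : √(μ i) ≤ 1 := Real.sqrt_le_one.2 (hμ1 i)
    have := hsqrt i
    nlinarith [hsqrt0 i]
  linarith

/-! ### Perturbation of the leading eigenvectors -/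

lemma sum_castLE {N k : ℕ} (h : k ≤ N) (f : Fin N → ℝ) :
    ∑ a : Fin k, f (Fin.castLE h a) = ∑ i : Fin N, if (i : ℕ) < k then f i else 0 := by
  obtain ⟨l, rfl⟩ := Nat.exists_eq_add_of_le h
  rw [Fin.sum_univ_add]
  simp [Fin.castAdd]

/-- Quantitative form of the fact that a weighted sum of decreasing numbers `lam i`, with weights
in `[0, 1]` of total weight `k`, is largest when the weight is on the first `k` of them. -/
lemma gap_mul_le_sum_sub_sum {N k : ℕ} (hk : 1 ≤ k) (hkN : k < N) {lam p : Fin N → ℝ}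
    (hlam : Antitone lam) (hp0 : ∀ i, 0 ≤ p i) (hp1 : ∀ i, p i ≤ 1) (hp : ∑ i, p i = k) :
    (lam ⟨k - 1, by omega⟩ - lam ⟨k, hkN⟩) * (k - ∑ a : Fin k, p (Fin.castLE hkN.le a))
      ≤ ∑ a : Fin k, lam (Fin.castLE hkN.le a) - ∑ i, lam i * p i := by
  set l1 := lam ⟨k - 1, by omega⟩ with hl1
  set l2 := lam ⟨k, hkN⟩ with hl2
  have hcard : ∑ i : Fin N, (if (i : ℕ) < k then (1 : ℝ) else 0) = k := by
    rw [← sum_castLE hkN.le fun _ => 1]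
    simp
  rw [sum_castLE hkN.le p, sum_castLE hkN.le lam]
  calc (l1 - l2) * (k - ∑ i : Fin N, if (i : ℕ) < k then p i else 0)
      = ∑ i : Fin N, (l1 * ((if (i : ℕ) < k then 1 else 0) - if (i : ℕ) < k then p i else 0)
          - l2 * (p i - if (i : ℕ) < k then p i else 0)) := by
        rw [Finset.sum_sub_distrib, ← Finset.mul_sum, ← Finset.mul_sum, Finset.sum_sub_distrib,
          Finset.sum_sub_distrib, hcard, hp]
        ring
    _ ≤ ∑ i : Fin N, ((if (i : ℕ) < k then lam i else 0) - lam i * p i) := by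
        refine Finset.sum_le_sum fun i _ => ?_
        have h0 := hp0 i
        have h1 := hp1 i
        split_ifs with hi
        · have : l1 ≤ lam i := hlam (Fin.le_def.2 (by change (i : ℕ) ≤ k - 1; omega) : i ≤ ⟨k - 1, by omega⟩)
          nlinarith
        · have : lam i ≤ l2 := hlam (Fin.le_def.2 (by change k ≤ (i : ℕ); omega) : (⟨k, hkN⟩ : Fin N) ≤ i)
          nlinarith
    _ = _ := Finset.sum_sub_distrib _ _

lemma transpose_mul_self_of_mem {ι : Type*} [Fintype ι] [DecidableEq ι] {V : Matrix ι ι ℝ}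
    (h : V ∈ Matrix.orthogonalGroup ι ℝ) : Vᵀ * V = 1 :=
  (Matrix.mem_orthogonalGroup_iff' _ _).1 h

lemma mul_transpose_self_of_mem {ι : Type*} [Fintype ι] [DecidableEq ι] {V : Matrix ι ι ℝ}
    (h : V ∈ Matrix.orthogonalGroup ι ℝ) : V * Vᵀ = 1 :=
  (Matrix.mem_orthogonalGroup_iff _ _).1 h

lemma firstCols_transpose_mul_mul_firstCols {N k : ℕ} (h : k ≤ N)
    (U A V : Matrix (Fin N) (Fin N) ℝ) :
    (firstCols h U)ᵀ * A * firstCols h V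
      = (Uᵀ * A * V).submatrix (Fin.castLE h) (Fin.castLE h) := by
  ext a b
  simp [firstCols, Matrix.mul_apply]

lemma firstCols_orthonormal {N k : ℕ} (h : k ≤ N) {V : Matrix (Fin N) (Fin N) ℝ}
    (hV : V ∈ Matrix.orthogonalGroup (Fin N) ℝ) : (firstCols h V)ᵀ * firstCols h V = 1 := by
  have := firstCols_transpose_mul_mul_firstCols h V 1 V
  rw [Matrix.mul_one, Matrix.mul_one, transpose_mul_self_of_mem hV] at this
  rw [this]
  exact Matrix.submatrix_one _ (Fin.castLE_injective h)

/-- Ky Fan's principle with a gap: a `k`-frame is worse than the leading eigenvectors at maximizing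
`tr (Yᵀ A Y)` by at least the spectral gap times the squared sines of the angles between them. -/
lemma gap_mul_le_trace_sub_trace {N k : ℕ} (hk : 1 ≤ k) (hkN : k < N)
    {A V V' : Matrix (Fin N) (Fin N) ℝ} {lam : Fin N → ℝ}
    (hV : IsOrderedEigendecomposition A lam V) (hV' : V' ∈ Matrix.orthogonalGroup (Fin N) ℝ) :
    (lam ⟨k - 1, by omega⟩ - lam ⟨k, hkN⟩) *
        (k - (((firstCols hkN.le V)ᵀ * firstCols hkN.le V')ᵀ *
          ((firstCols hkN.le V)ᵀ * firstCols hkN.le V')).trace)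
      ≤ ((firstCols hkN.le V)ᵀ * A * firstCols hkN.le V).trace
        - ((firstCols hkN.le V')ᵀ * A * firstCols hkN.le V').trace := by
  have hVV := transpose_mul_self_of_mem hV.orthogonal
  have hVV' := mul_transpose_self_of_mem hV.orthogonal
  have hWW := transpose_mul_self_of_mem hV'
  set G := Vᵀ * V' with hG
  have hGG : Gᵀ * G = 1 := by
    rw [hG, Matrix.transpose_mul, Matrix.transpose_transpose, Matrix.mul_assoc,
      ← Matrix.mul_assoc V, hVV', Matrix.one_mul, hWW]
  have hGG' : G * Gᵀ = 1 := mul_eq_one_comm.1 hGG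
  have hA : A = V * Matrix.diagonal lam * Vᵀ := by
    rw [← hV.eigen, Matrix.mul_assoc, hVV', Matrix.mul_one]
  have hcol : ∀ j, ∑ i, G i j ^ 2 = 1 := fun j => by
    have := congrFun (congrFun hGG j) j
    simpa [Matrix.mul_apply, sq] using this
  have hrow : ∀ i, ∑ j, G i j ^ 2 = 1 := fun i => by
    have := congrFun (congrFun hGG' i) i
    simpa [Matrix.mul_apply, sq] using this
  have hmain := gap_mul_le_sum_sub_sum hk hkN (lam := lam)
    (p := fun i => ∑ a : Fin k, G i (Fin.castLE hkN.le a) ^ 2) hV.antitone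
    (fun i => Finset.sum_nonneg fun _ _ => sq_nonneg _)
    (fun i => by
      rw [← hrow i, sum_castLE hkN.le fun j => G i j ^ 2]
      refine Finset.sum_le_sum fun j _ => ?_
      split_ifs
      · exact le_rfl
      · exact sq_nonneg _)
    (by
      rw [Finset.sum_comm]
      simp [hcol])
  have hM : (firstCols hkN.le V)ᵀ * firstCols hkN.le V'
      = G.submatrix (Fin.castLE hkN.le) (Fin.castLE hkN.le) := by
    have := firstCols_transpose_mul_mul_firstCols hkN.le V 1 V'
    rwa [Matrix.mul_one, Matrix.mul_one] at this
  have h1 : Vᵀ * A * V = Matrix.diagonal lam := by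
    rw [Matrix.mul_assoc, hV.eigen, ← Matrix.mul_assoc, hVV, Matrix.one_mul]
  have h2 : V'ᵀ * A * V' = Gᵀ * Matrix.diagonal lam * G := by
    rw [hA, hG, Matrix.transpose_mul, Matrix.transpose_transpose]
    simp only [Matrix.mul_assoc]
  rw [hM, trace_transpose_mul_self_eq_sum, firstCols_transpose_mul_mul_firstCols,
    firstCols_transpose_mul_mul_firstCols, h1, h2]
  have ht1 : ((Matrix.diagonal lam).submatrix (Fin.castLE hkN.le) (Fin.castLE hkN.le)).trace
      = ∑ a : Fin k, lam (Fin.castLE hkN.le a) := by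
    simp [Matrix.trace]
  have ht2 : ((Gᵀ * Matrix.diagonal lam * G).submatrix
      (Fin.castLE hkN.le) (Fin.castLE hkN.le)).trace
      = ∑ i, lam i * ∑ a : Fin k, G i (Fin.castLE hkN.le a) ^ 2 := by
    simp only [Matrix.trace, Matrix.diag, Matrix.submatrix_apply, Matrix.mul_apply (M := _ * _),
      Matrix.mul_diagonal, Matrix.transpose_apply, Finset.mul_sum]
    rw [Finset.sum_comm]
    exact Finset.sum_congr rfl fun i _ => Finset.sum_congr rfl fun a _ => by ring
  rw [ht1, ht2]
  exact hmain

/-- A Davis–Kahan bound on the sines of the angles between the leading eigenspaces of `A` and `A'`,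
in terms of the gap of `A` only. Ky Fan's principle for `A` and for `A'` bounds
`gap * ‖sin Θ‖²` by the pairing of `A - A'` with the difference of the two projections, whose squared
Frobenius norm is `2 ‖sin Θ‖²`. -/
lemma gap_sq_mul_sin_sq_le {N k : ℕ} (hk : 1 ≤ k) (hkN : k < N)
    {A A' V V' : Matrix (Fin N) (Fin N) ℝ} {lam lam' : Fin N → ℝ}
    (hV : IsOrderedEigendecomposition A lam V) (hV' : IsOrderedEigendecomposition A' lam' V')
    {α : ℝ} (hα : 0 < α) (hgap : α ≤ lam ⟨k - 1, by omega⟩ - lam ⟨k, hkN⟩)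
    {X Y : Matrix (Fin N) (Fin k) ℝ}
    (hXdef : X = firstCols hkN.le V) (hYdef : Y = firstCols hkN.le V') :
    α ^ 2 * (k - ((Xᵀ * Y)ᵀ * (Xᵀ * Y)).trace) ≤ 2 * ((A - A')ᵀ * (A - A')).trace := by
  have hX : Xᵀ * X = 1 := hXdef ▸ firstCols_orthonormal hkN.le hV.orthogonal
  have hY : Yᵀ * Y = 1 := hYdef ▸ firstCols_orthonormal hkN.le hV'.orthogonal
  have h1 := gap_mul_le_trace_sub_trace hk hkN hV hV'.orthogonal
  have h2 := gap_mul_le_trace_sub_trace hk hkN hV' hV.orthogonal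
  rw [← hXdef, ← hYdef] at h1 h2
  have hcyc : ∀ B : Matrix (Fin N) (Fin N) ℝ, ∀ Z : Matrix (Fin N) (Fin k) ℝ,
      (Zᵀ * B * Z).trace = (B * (Z * Zᵀ)).trace := by
    intro B Z
    rw [Matrix.mul_assoc, Matrix.trace_mul_comm, Matrix.mul_assoc]
  have hXY : (X * Xᵀ * (Y * Yᵀ)).trace = ((Xᵀ * Y)ᵀ * (Xᵀ * Y)).trace := by
    rw [Matrix.trace_mul_comm, Matrix.transpose_mul, Matrix.transpose_transpose, Matrix.mul_assoc,
      Matrix.trace_mul_comm]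
    simp only [Matrix.mul_assoc]
  have hYX : (Y * Yᵀ * (X * Xᵀ)).trace = ((Xᵀ * Y)ᵀ * (Xᵀ * Y)).trace := by
    rw [Matrix.trace_mul_comm, hXY]
  have hswap : ((Yᵀ * X)ᵀ * (Yᵀ * X)).trace = ((Xᵀ * Y)ᵀ * (Xᵀ * Y)).trace := by
    rw [Matrix.trace_mul_comm]
    simp only [Matrix.transpose_mul, Matrix.transpose_transpose]
  have hproj : ∀ Z : Matrix (Fin N) (Fin k) ℝ, Zᵀ * Z = 1 → (Z * Zᵀ * (Z * Zᵀ)).trace = k := by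
    intro Z hZ
    rw [Matrix.mul_assoc, ← Matrix.mul_assoc Zᵀ, hZ, Matrix.one_mul, Matrix.trace_mul_comm, hZ]
    simp
  rw [hswap] at h2
  set s2 := (k : ℝ) - ((Xᵀ * Y)ᵀ * (Xᵀ * Y)).trace with hs2
  have hnorm : ((X * Xᵀ - Y * Yᵀ)ᵀ * (X * Xᵀ - Y * Yᵀ)).trace = 2 * s2 := by
    have hsymm : (X * Xᵀ - Y * Yᵀ)ᵀ = X * Xᵀ - Y * Yᵀ := by
      simp [Matrix.transpose_mul]
    rw [hsymm, Matrix.sub_mul, Matrix.mul_sub, Matrix.mul_sub]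
    simp only [Matrix.trace_sub, hproj X hX, hproj Y hY, hXY, hYX]
    rw [hs2]
    ring
  have hs0 : 0 ≤ s2 := by
    have : 0 ≤ 2 * s2 := by
      rw [← hnorm, trace_transpose_mul_self_eq_sum]
      positivity
    linarith
  have hcs := trace_transpose_mul_sq_le (A - A')ᵀ (X * Xᵀ - Y * Yᵀ)
  rw [hnorm, Matrix.transpose_transpose, Matrix.trace_mul_comm (A - A') (A - A')ᵀ] at hcs
  have hgap' : 0 ≤ lam' ⟨k - 1, by omega⟩ - lam' ⟨k, hkN⟩ :=
    sub_nonneg.2 (hV'.antitone (Fin.mk_le_mk.2 (by omega)))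
  have hpair : α * s2 ≤ ((A - A') * (X * Xᵀ - Y * Yᵀ)).trace := by
    have h3 : ((A - A') * (X * Xᵀ - Y * Yᵀ)).trace
        = ((Xᵀ * A * X).trace - (Yᵀ * A * Y).trace)
          + ((Yᵀ * A' * Y).trace - (Xᵀ * A' * X).trace) := by
      rw [Matrix.sub_mul, Matrix.mul_sub, Matrix.mul_sub]
      simp only [Matrix.trace_sub, hcyc]
      ring
    rw [h3]
    have := mul_nonneg hgap' hs0
    have := mul_le_mul_of_nonneg_right hgap hs0
    linarith
  rcases hs0.eq_or_lt with h0 | h0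
  · rw [← h0, mul_zero, trace_transpose_mul_self_eq_sum]
    positivity
  · have hsq : (α * s2) ^ 2 ≤ ((A - A')ᵀ * (A - A')).trace * (2 * s2) :=
      (pow_le_pow_left₀ (by positivity) hpair 2).trans hcs
    refine le_of_mul_le_mul_right ?_ h0
    linarith

section
open scoped Matrix.Norms.Frobenius

lemma frobenius_norm_sq_eq_trace {ι κ : Type*} [Fintype ι] [Fintype κ] (A : Matrix ι κ ℝ) :
    ‖A‖ ^ 2 = (Aᵀ * A).trace := by
  rw [trace_transpose_mul_self_eq_sum, Matrix.frobenius_norm_def, ← Real.sqrt_eq_rpow,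
    Real.sq_sqrt (by positivity)]
  simp

/-- An optimal rotation of the leading eigenvectors of `A` brings their rows close to those of the
leading eigenvectors of `A'`. -/
lemma norm_row_sub_sq_le {N k : ℕ} (hk : 1 ≤ k) (hkN : k < N)
    {A A' V V' : Matrix (Fin N) (Fin N) ℝ} {lam lam' : Fin N → ℝ}
    (hV : IsOrderedEigendecomposition A lam V) (hV' : IsOrderedEigendecomposition A' lam' V')
    {α : ℝ} (hα : 0 < α) (hgap : α ≤ lam ⟨k - 1, by omega⟩ - lam ⟨k, hkN⟩)
    (hsmall : 2 * ((A - A')ᵀ * (A - A')).trace < α ^ 2) {Q : Matrix (Fin k) (Fin k) ℝ}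
    (hQ : IsBestRotation (firstCols hkN.le V) (firstCols hkN.le V') Q) (i : Fin N) :
    α ^ 2 * ‖(WithLp.toLp 2 (firstCols hkN.le V' i - firstCols hkN.le V i ᵥ* Q) :
        EuclideanSpace ℝ (Fin k))‖ ^ 2 ≤ 4 * ((A - A')ᵀ * (A - A')).trace := by
  have hsin := gap_sq_mul_sin_sq_le hk hkN hV hV' hα hgap rfl rfl
  set X := firstCols hkN.le V with hXdef
  set Y := firstCols hkN.le V' with hYdef
  have hα2 : 0 < α ^ 2 := by positivity
  have hlt : (k : ℝ) - ((Xᵀ * Y)ᵀ * (Xᵀ * Y)).trace < 1 := by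
    by_contra! h
    have := mul_le_mul_of_nonneg_left h hα2.le
    linarith
  obtain ⟨R, hR, hRle⟩ := exists_orthogonal_trace_sub_le (X := X) (Y := Y)
    (firstCols_orthonormal hkN.le hV.orthogonal) (firstCols_orthonormal hkN.le hV'.orthogonal)
    (by simpa using hlt)
  rw [← frobenius_norm_sq_eq_trace, Fintype.card_fin] at hRle
  have hrow : ‖(WithLp.toLp 2 (Y i - X i ᵥ* Q) : EuclideanSpace ℝ (Fin k))‖ ^ 2
      ≤ ‖Y - X * Q‖ ^ 2 := by
    rw [EuclideanSpace.real_norm_sq_eq, frobenius_norm_sq_eq_trace,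
      trace_transpose_mul_self_eq_sum]
    exact Finset.single_le_sum (f := fun i => ∑ j, (Y - X * Q) i j ^ 2)
      (fun _ _ => Finset.sum_nonneg fun _ _ => sq_nonneg _) (Finset.mem_univ i)
  have hbest := pow_le_pow_left₀ (norm_nonneg _) (hQ.2 R hR) 2
  have := mul_le_mul_of_nonneg_left (hrow.trans (hbest.trans hRle)) hα2.le
  linarith

end

/-! ### Perturbation of the affinity matrix -/

lemma weight_pos {N d : ℕ} (σ : ℝ) (x : Fin N → EuclideanSpace ℝ (Fin d)) (i j : Fin N) :
    0 < weight σ x i j := Real.exp_pos _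

lemma weight_comm {N d : ℕ} (σ : ℝ) (x : Fin N → EuclideanSpace ℝ (Fin d)) (i j : Fin N) :
    weight σ x i j = weight σ x j i := by
  simp only [weight, Matrix.of_apply, norm_sub_rev]

lemma degree_pos {N d : ℕ} (σ : ℝ) (x : Fin N → EuclideanSpace ℝ (Fin d)) (i : Fin N) :
    0 < degree σ x i :=
  Finset.sum_pos (fun _ _ => weight_pos σ x _ _) ⟨i, Finset.mem_univ i⟩

lemma affinity_apply {N d : ℕ} (σ : ℝ) (x : Fin N → EuclideanSpace ℝ (Fin d)) (i j : Fin N) :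
    affinity σ x i j = (√(degree σ x i))⁻¹ * weight σ x i j * (√(degree σ x j))⁻¹ := by
  simp [affinity, Matrix.mul_diagonal, Matrix.diagonal_mul]

lemma affinity_nonneg {N d : ℕ} (σ : ℝ) (x : Fin N → EuclideanSpace ℝ (Fin d)) (i j : Fin N) :
    0 ≤ affinity σ x i j := by
  rw [affinity_apply]
  have := weight_pos σ x i j
  positivity

/-- The quadratic form of the affinity matrix is bounded by the identity:
`2 u i * u j ≤ u i ^ 2 + u j ^ 2` for `u = D^{-1/2} v`, summed with the weights. -/
lemma eigenvalue_affinity_le_one {N d : ℕ} {σ : ℝ} {x : Fin N → EuclideanSpace ℝ (Fin d)}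
    {lam : Fin N → ℝ} {V : Matrix (Fin N) (Fin N) ℝ}
    (hV : IsOrderedEigendecomposition (affinity σ x) lam V) (l : Fin N) : lam l ≤ 1 := by
  have hVV := transpose_mul_self_of_mem hV.orthogonal
  have hunit : ∑ i, V i l ^ 2 = 1 := by
    have := congrFun (congrFun hVV l) l
    simpa [Matrix.mul_apply, sq] using this
  set u : Fin N → ℝ := fun i => (√(degree σ x i))⁻¹ * V i l with hu
  have hlam : lam l = ∑ i, ∑ j, weight σ x i j * (u i * u j) := by
    have h : (Vᵀ * (affinity σ x * V)) l l = lam l := by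
      rw [hV.eigen, ← Matrix.mul_assoc, hVV, Matrix.one_mul, Matrix.diagonal_apply_eq]
    rw [← h]
    simp only [Matrix.mul_apply (M := Vᵀ), Matrix.mul_apply (N := V), Matrix.transpose_apply,
      Finset.mul_sum, affinity_apply, hu]
    exact Finset.sum_congr rfl fun i _ => Finset.sum_congr rfl fun j _ => by ring
  have hdeg : ∑ i, ∑ j, weight σ x i j * u i ^ 2 = 1 := by
    rw [← hunit]
    refine Finset.sum_congr rfl fun i _ => ?_
    have hd := degree_pos σ x i
    rw [← Finset.sum_mul, hu]
    change degree σ x i * _ = _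
    rw [mul_pow, inv_pow, Real.sq_sqrt hd.le, mul_inv_cancel_left₀ hd.ne']
  have hdeg' : ∑ i, ∑ j, weight σ x i j * u j ^ 2 = 1 := by
    rw [Finset.sum_comm, ← hdeg]
    exact Finset.sum_congr rfl fun i _ => Finset.sum_congr rfl fun j _ => by rw [weight_comm]
  calc lam l = ∑ i, ∑ j, weight σ x i j * (u i * u j) := hlam
    _ ≤ ∑ i, ∑ j, (weight σ x i j * u i ^ 2 / 2 + weight σ x i j * u j ^ 2 / 2) := by
        refine Finset.sum_le_sum fun i _ => Finset.sum_le_sum fun j _ => ?_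
        nlinarith [mul_nonneg (weight_pos σ x i j).le (sq_nonneg (u i - u j))]
    _ = 1 := by
        simp_rw [Finset.sum_add_distrib, ← Finset.sum_div]
        rw [hdeg, hdeg']
        norm_num

/-- Every degree is at least `N e^{-K}`, so the entries of the affinity matrix are `O(1 / N)`. -/
lemma affinity_le {N d : ℕ} {σ K : ℝ} {x : Fin N → EuclideanSpace ℝ (Fin d)} (hN : 0 < N)
    (hσ : 0 < σ) (hK : ∀ i j, ‖x i - x j‖ ^ 2 / (2 * σ) ≤ K) (i j : Fin N) :
    affinity σ x i j ≤ Real.exp K / N := by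
  have hN' : (0 : ℝ) < N := by exact_mod_cast hN
  have hdeg : ∀ i, N * Real.exp (-K) ≤ degree σ x i := by
    intro i
    have := Finset.card_nsmul_le_sum Finset.univ (fun j => weight σ x i j) (Real.exp (-K))
      (fun j _ => Real.exp_le_exp.2 (neg_le_neg (hK i j)))
    simpa [degree] using this
  have hw1 : weight σ x i j ≤ 1 := Real.exp_le_one_iff.2 (neg_nonpos.2 (by positivity))
  have hw0 := weight_pos σ x i j
  rw [affinity_apply]
  calc (√(degree σ x i))⁻¹ * weight σ x i j * (√(degree σ x j))⁻¹
      ≤ (√(N * Real.exp (-K)))⁻¹ * 1 * (√(N * Real.exp (-K)))⁻¹ := by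
        gcongr
        · exact hdeg i
        · exact hdeg j
    _ = Real.exp K / N := by
        rw [mul_one, ← mul_inv, Real.mul_self_sqrt (by positivity), Real.exp_neg, mul_inv, inv_inv]
        field_simp

lemma affinity_le_mul {N d d' : ℕ} {σ t : ℝ} {x : Fin N → EuclideanSpace ℝ (Fin d)}
    {x' : Fin N → EuclideanSpace ℝ (Fin d')}
    (h : ∀ i j, weight σ x i j ≤ Real.exp t * weight σ x' i j)
    (h' : ∀ i j, weight σ x' i j ≤ Real.exp t * weight σ x i j) (i j : Fin N) :
    affinity σ x i j ≤ Real.exp (2 * t) * affinity σ x' i j := by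
  have hq : √(Real.exp t) * √(Real.exp t) = Real.exp t := Real.mul_self_sqrt (Real.exp_pos _).le
  have hq0 : 0 < √(Real.exp t) := Real.sqrt_pos.2 (Real.exp_pos _)
  have hinv : ∀ i, (√(degree σ x i))⁻¹ ≤ √(Real.exp t) * (√(degree σ x' i))⁻¹ := by
    intro i
    have hd := Real.sqrt_pos.2 (degree_pos σ x i)
    have hd' := Real.sqrt_pos.2 (degree_pos σ x' i)
    have hle : degree σ x' i ≤ Real.exp t * degree σ x i := by
      unfold degree
      rw [Finset.mul_sum]
      exact Finset.sum_le_sum fun j _ => h' i j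
    have := Real.sqrt_le_sqrt hle
    rw [Real.sqrt_mul (Real.exp_pos _).le] at this
    rw [← div_eq_mul_inv, inv_le_iff_one_le_mul₀ hd, div_mul_eq_mul_div, one_le_div hd']
    exact this
  have hw0 := weight_pos σ x i j
  have hw0' := weight_pos σ x' i j
  rw [affinity_apply, affinity_apply]
  calc (√(degree σ x i))⁻¹ * weight σ x i j * (√(degree σ x j))⁻¹
      ≤ (√(Real.exp t) * (√(degree σ x' i))⁻¹) * (Real.exp t * weight σ x' i j)
          * (√(Real.exp t) * (√(degree σ x' j))⁻¹) := by
        gcongr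
        · exact hinv i
        · exact h i j
        · exact hinv j
    _ = (√(Real.exp t) * √(Real.exp t)) * Real.exp t *
          ((√(degree σ x' i))⁻¹ * weight σ x' i j * (√(degree σ x' j))⁻¹) := by ring
    _ = _ := by rw [hq, ← Real.exp_add, two_mul]

/-- If all squared distances are preserved up to a relative error `δ`, the affinity matrix moves by
`O(δ)` in the Frobenius norm, uniformly in the number of points. -/
lemma trace_affinity_sub_le {N d d' : ℕ} {σ K δ : ℝ} {x : Fin N → EuclideanSpace ℝ (Fin d)}
    {x' : Fin N → EuclideanSpace ℝ (Fin d')} (hN : 0 < N) (hσ : 0 < σ)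
    (hK : ∀ i j, ‖x i - x j‖ ^ 2 / (2 * σ) ≤ K) (hK0 : 0 ≤ K) (hδ : 0 ≤ δ) (hδK : 2 * (δ * K) ≤ 1)
    (hdist : ∀ i j, |‖x' i - x' j‖ ^ 2 - ‖x i - x j‖ ^ 2| ≤ δ * ‖x i - x j‖ ^ 2) :
    ((affinity σ x - affinity σ x')ᵀ * (affinity σ x - affinity σ x')).trace
      ≤ (4 * (δ * K) * Real.exp K) ^ 2 := by
  have hN' : (0 : ℝ) < N := by exact_mod_cast hN
  have ht0 : 0 ≤ δ * K := by positivity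
  have hexponent : ∀ i j,
      |‖x' i - x' j‖ ^ 2 / (2 * σ) - ‖x i - x j‖ ^ 2 / (2 * σ)| ≤ δ * K := by
    intro i j
    rw [← sub_div, abs_div, abs_of_pos (by positivity : 0 < 2 * σ)]
    calc _ ≤ δ * ‖x i - x j‖ ^ 2 / (2 * σ) := by gcongr; exact hdist i j
      _ = δ * (‖x i - x j‖ ^ 2 / (2 * σ)) := by ring
      _ ≤ δ * K := mul_le_mul_of_nonneg_left (hK i j) hδ
  have hw : ∀ i j, weight σ x i j ≤ Real.exp (δ * K) * weight σ x' i j := by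
    intro i j
    simp only [weight, Matrix.of_apply]
    rw [← Real.exp_add]
    exact Real.exp_le_exp.2 (by linarith [(abs_le.1 (hexponent i j)).2])
  have hw' : ∀ i j, weight σ x' i j ≤ Real.exp (δ * K) * weight σ x i j := by
    intro i j
    simp only [weight, Matrix.of_apply]
    rw [← Real.exp_add]
    exact Real.exp_le_exp.2 (by linarith [(abs_le.1 (hexponent i j)).1])
  have hexp : Real.exp (2 * (δ * K)) ≤ 1 + 4 * (δ * K) := by
    have := (abs_le.1 (Real.abs_exp_sub_one_le
      (x := 2 * (δ * K)) (by rwa [abs_of_nonneg (by positivity)]))).2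
    rw [abs_of_nonneg (by positivity)] at this
    linarith
  have hentry : ∀ i j, |affinity σ x i j - affinity σ x' i j|
      ≤ 4 * (δ * K) * Real.exp K / N := by
    intro i j
    have ha := affinity_nonneg σ x i j
    have ha' := affinity_nonneg σ x' i j
    have h1 := affinity_le_mul hw hw' i j
    have h2 := affinity_le_mul hw' hw i j
    have h3 := affinity_le hN hσ hK i j
    have h4 : |affinity σ x i j - affinity σ x' i j| ≤ 4 * (δ * K) * affinity σ x i j := by
      have h5 := mul_le_mul_of_nonneg_right hexp ha
      have h6 := mul_le_mul_of_nonneg_right hexp ha'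
      rw [abs_le]
      refine ⟨by linarith, ?_⟩
      rcases le_total (affinity σ x i j) (affinity σ x' i j) with h7 | h7
      · have : 0 ≤ 4 * (δ * K) * affinity σ x i j := by positivity
        linarith
      · have := mul_le_mul_of_nonneg_left h7 (by positivity : 0 ≤ 4 * (δ * K))
        linarith
    refine h4.trans ((mul_le_mul_of_nonneg_left h3 (by positivity)).trans (le_of_eq ?_))
    ring
  rw [trace_transpose_mul_self_eq_sum]
  calc ∑ i, ∑ j, (affinity σ x - affinity σ x') i j ^ 2
      ≤ ∑ _i : Fin N, ∑ _j : Fin N, (4 * (δ * K) * Real.exp K / N) ^ 2 := by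
        refine Finset.sum_le_sum fun i _ => Finset.sum_le_sum fun j _ => ?_
        rw [← sq_abs]
        exact pow_le_pow_left₀ (abs_nonneg _) (hentry i j) 2
    _ = (4 * (δ * K) * Real.exp K) ^ 2 := by
        simp only [Finset.sum_const, Finset.card_univ, Fintype.card_fin, nsmul_eq_mul]
        field_simp

/-! ### The high-probability bound -/

lemma norm_row_sub_le_two {N k : ℕ} (h : k ≤ N) {V V' : Matrix (Fin N) (Fin N) ℝ}
    (hV : V ∈ Matrix.orthogonalGroup (Fin N) ℝ) (hV' : V' ∈ Matrix.orthogonalGroup (Fin N) ℝ)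
    {Q : Matrix (Fin k) (Fin k) ℝ} (hQ : Q ∈ Matrix.orthogonalGroup (Fin k) ℝ) (i : Fin N) :
    ‖(WithLp.toLp 2 (firstCols h V' i - firstCols h V i ᵥ* Q) : EuclideanSpace ℝ (Fin k))‖
      ≤ 2 := by
  have hrow : ∀ U ∈ Matrix.orthogonalGroup (Fin N) ℝ,
      ‖(WithLp.toLp 2 (firstCols h U i) : EuclideanSpace ℝ (Fin k))‖ ≤ 1 := by
    intro U hU
    rw [← sq_le_one_iff₀ (norm_nonneg _), EuclideanSpace.real_norm_sq_eq]
    have hfull : ∑ j, U i j ^ 2 = 1 := by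
      have := congrFun (congrFun (mul_transpose_self_of_mem hU) i) i
      simpa [Matrix.mul_apply, sq] using this
    rw [← hfull]
    refine (sum_castLE h fun j => U i j ^ 2).le.trans (Finset.sum_le_sum fun j _ => ?_)
    split_ifs
    · exact le_rfl
    · exact sq_nonneg _
  have hrot : ‖(WithLp.toLp 2 (firstCols h V i ᵥ* Q) : EuclideanSpace ℝ (Fin k))‖
      = ‖(WithLp.toLp 2 (firstCols h V i) : EuclideanSpace ℝ (Fin k))‖ := by
    have hdot : (firstCols h V i ᵥ* Q) ⬝ᵥ (firstCols h V i ᵥ* Q)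
        = firstCols h V i ⬝ᵥ firstCols h V i := by
      rw [← Matrix.dotProduct_mulVec, ← Matrix.mulVec_transpose, Matrix.mulVec_mulVec,
        mul_transpose_self_of_mem hQ, Matrix.one_mulVec]
    rw [← sq_eq_sq₀ (norm_nonneg _) (norm_nonneg _), EuclideanSpace.real_norm_sq_eq,
      EuclideanSpace.real_norm_sq_eq]
    simpa [dotProduct, sq] using hdot
  rw [WithLp.toLp_sub]
  refine (norm_sub_le _ _).trans ?_
  rw [hrot]
  linarith [hrow V hV, hrow V' hV']

lemma gaussianMatrix_exists_distortion_le {N m n : ℕ} (hm : 0 < m)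
    (x : Fin N → EuclideanSpace ℝ (Fin n)) {δ : ℝ} (hδ : 0 ≤ δ) (hδ1 : δ ≤ 1) :
    gaussianMatrix m n {Φ | ∃ i j, δ * ‖x i - x j‖ ^ 2 <
        |‖compress (Matrix.of Φ) x i - compress (Matrix.of Φ) x j‖ ^ 2 - ‖x i - x j‖ ^ 2|}
      ≤ ENNReal.ofReal ((N : ℝ) ^ 2 * (2 * Real.exp (-(δ ^ 2 * m / 8)))) := by
  simp only [Set.ofPred_exists]
  refine (measure_iUnion_fintype_le _ _).trans ?_
  refine (Finset.sum_le_sum fun i _ => (measure_iUnion_fintype_le _ _).trans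
    (Finset.sum_le_sum fun j _ => gaussianMatrix_distortion_le hm x i j hδ hδ1)).trans ?_
  simp only [Finset.sum_const, Finset.card_univ, Fintype.card_fin, nsmul_eq_mul]
  rw [ENNReal.ofReal_mul (p := (N : ℝ) ^ 2) (by positivity), ← mul_assoc, ← sq,
    ENNReal.ofReal_pow (by positivity), ENNReal.ofReal_natCast]

/-- The union bound over the `N ^ 2` pairs of points costs nothing, because the distortion that
matters grows with `N` and the exponent with it. -/
lemma sq_mul_two_mul_exp_le {N : ℕ} (hN : 2 ≤ N) {η y : ℝ} (hη : 0 < η) (hη1 : η < 1)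
    (hy : 4 - Real.log η ≤ y) :
    (N : ℝ) ^ 2 * (2 * Real.exp (-((N : ℝ) ^ 2 * y))) ≤ min η (Real.exp (-y)) := by
  have hlog : Real.log η < 0 := Real.log_neg hη hη1
  have hN' : (2 : ℝ) ≤ N := by exact_mod_cast hN
  have hN4 : (4 : ℝ) ≤ (N : ℝ) ^ 2 := by nlinarith
  have h1 : 2 * (N : ℝ) ^ 2 ≤ Real.exp (2 * (N : ℝ) ^ 2) := by
    linarith [Real.add_one_le_exp (2 * (N : ℝ) ^ 2)]
  have h2 : (N : ℝ) ^ 2 * (2 * Real.exp (-((N : ℝ) ^ 2 * y))) ≤ Real.exp (-y) := by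
    calc (N : ℝ) ^ 2 * (2 * Real.exp (-((N : ℝ) ^ 2 * y)))
        = 2 * (N : ℝ) ^ 2 * Real.exp (-((N : ℝ) ^ 2 * y)) := by ring
      _ ≤ Real.exp (2 * (N : ℝ) ^ 2) * Real.exp (-((N : ℝ) ^ 2 * y)) :=
          mul_le_mul_of_nonneg_right h1 (Real.exp_pos _).le
      _ ≤ Real.exp (-y) := by
          rw [← Real.exp_add]
          refine Real.exp_le_exp.2 ?_
          nlinarith [mul_nonneg (sub_nonneg.2 hN4) (by linarith : 0 ≤ y - 2)]
  refine le_min (h2.trans ?_) h2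
  calc Real.exp (-y) ≤ Real.exp (Real.log η) := Real.exp_le_exp.2 (by linarith)
    _ = η := Real.exp_log hη

/-- For `ε ≤ 1/2` the logarithmic factor in the number of measurements is at least `1`. -/
lemma one_le_mul_log {n r : ℕ} (hr : 1 ≤ r) (hrn : r ≤ n) {ε : ℝ} (hε : 0 < ε) (hε2 : ε ≤ 1 / 2) :
    1 ≤ ε ^ 2 * ((r : ℝ) / ε ^ 2 * Real.log ((n : ℝ) / (ε ^ 2 * (r : ℝ)))) := by
  have hr' : (1 : ℝ) ≤ r := by exact_mod_cast hr
  have hrn' : (r : ℝ) ≤ n := by exact_mod_cast hrn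
  have harg : 4 ≤ (n : ℝ) / (ε ^ 2 * r) := by
    rw [le_div_iff₀ (by positivity)]
    have : ε ^ 2 ≤ 1 / 4 := by nlinarith
    nlinarith
  have hlog : 1 ≤ Real.log ((n : ℝ) / (ε ^ 2 * r)) := by
    rw [Real.le_log_iff_exp_le (by linarith)]
    linarith [Real.exp_one_lt_d9]
  have : ε ^ 2 * ((r : ℝ) / ε ^ 2 * Real.log ((n : ℝ) / (ε ^ 2 * (r : ℝ))))
      = r * Real.log ((n : ℝ) / (ε ^ 2 * (r : ℝ))) := by
    field_simp
  rw [this]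
  nlinarith

end CompressedSpectral
theorem theorem5 :
    ∀ K : ℝ, 0 < K → ∃ c : ℝ, 0 < c ∧ ∀ η : ℝ, 0 < η → η < 1 → ∃ C : ℝ, 0 < C ∧
      ∀ (N n m k r : ℕ) (hk : 1 ≤ k) (hkN : k < N) (_hr : 1 ≤ r) (_hrn : r ≤ n)
        (ε σ α : ℝ) (_hε : 0 < ε) (_hε1 : ε < 1) (_hσ : 0 < σ) (_hα : 0 < α)
        (x : Fin N → EuclideanSpace ℝ (Fin n))
        (_hsparse : ∃ B ∈ Matrix.orthogonalGroup (Fin n) ℝ,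
          ∀ i, CompressedSpectral.IsSparse r (B *ᵥ (x i).ofLp))
        (_hK : ∀ i j, ‖x i - x j‖ ^ 2 / (2 * σ) ≤ K)
        (lam : Fin N → ℝ) (V : Matrix (Fin N) (Fin N) ℝ)
        (_hV : CompressedSpectral.IsOrderedEigendecomposition
          (CompressedSpectral.affinity σ x) lam V)
        (_hgap : α ≤ lam ⟨k - 1, by omega⟩ - lam ⟨k, hkN⟩)
        (_htop : α ≤ lam ⟨k - 1, by omega⟩)
        (_hm : C * ((r : ℝ) / ε ^ 2 * Real.log ((n : ℝ) / (ε ^ 2 * (r : ℝ)))) ≤ (m : ℝ)),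
        CompressedSpectral.gaussianMatrix m n
            {Φ | ¬ ∀ (lam' : Fin N → ℝ) (V' : Matrix (Fin N) (Fin N) ℝ)
                (Q : Matrix (Fin k) (Fin k) ℝ),
              CompressedSpectral.IsOrderedEigendecomposition
                  (CompressedSpectral.affinity σ (CompressedSpectral.compress (Matrix.of Φ) x)) lam' V' →
              CompressedSpectral.IsBestRotation
                  (CompressedSpectral.firstCols hkN.le V)
                  (CompressedSpectral.firstCols hkN.le V') Q →
              ∀ i : Fin N,
                ‖(WithLp.toLp 2 (CompressedSpectral.firstCols hkN.le V' i -
                    CompressedSpectral.firstCols hkN.le V i ᵥ* Q) :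
                      EuclideanSpace ℝ (Fin k))‖
                  ≤ (1 + Real.sqrt 2) * ((N : ℝ) * ε / α)}
          ≤ ENNReal.ofReal (min η (Real.exp (-(c * ε ^ 2 * (m : ℝ))))) := by
  intro K hK0
  -- The distortion `δ = κ N ε` moves the affinity matrix by at most `N ε / 2`.
  set κ : ℝ := (8 * Real.exp K * (K + 1))⁻¹ with hκ
  have hκ0 : 0 < κ := by positivity
  have hκK : 4 * (κ * K) * Real.exp K ≤ 1 / 2 := by
    rw [hκ]
    have := Real.exp_pos K
    field_simp
    linarith
  have hκ1 : κ ≤ 1 := by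
    rw [hκ]
    refine inv_le_one_of_one_le₀ ?_
    nlinarith [Real.add_one_le_exp K]
  have hκK2 : 2 * (κ * K) ≤ 1 := by
    have h1 : 0 ≤ κ * K := by positivity
    nlinarith [Real.one_le_exp hK0.le]
  refine ⟨κ ^ 2 / 8, by positivity, fun η hη hη1 => ?_⟩
  have hlog : Real.log η < 0 := Real.log_neg hη hη1
  refine ⟨(4 - Real.log η) / (κ ^ 2 / 8), div_pos (by linarith) (by positivity), ?_⟩
  intro N n m k r hk hkN hr hrn ε σ α hε hε1 hσ hα x _ hK lam V hV hgap htop hm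
  have hNε : 0 < (N : ℝ) * ε := mul_pos (by exact_mod_cast (by omega : 0 < N)) hε
  rcases le_or_gt α (N * ε) with hcase | hcase
  · -- Rows of orthonormal frames have norm at most `1`, and `1 + √2 ≥ 2`.
    refine le_trans (le_of_eq ?_) zero_le
    convert measure_empty (μ := CompressedSpectral.gaussianMatrix m n)
    rw [Set.eq_empty_iff_forall_notMem]
    intro Φ hΦ
    refine hΦ fun lam' V' Q hV' hQ i => ?_
    refine (CompressedSpectral.norm_row_sub_le_two hkN.le hV.orthogonal hV'.orthogonal hQ.1
      i).trans ?_
    have h1 : 1 ≤ N * ε / α := (one_le_div hα).2 hcase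
    have h2 : 1 ≤ √2 := Real.one_le_sqrt.2 (by norm_num)
    nlinarith
  · have hα1 : α ≤ 1 := htop.trans (CompressedSpectral.eigenvalue_affinity_le_one hV _)
    have hN2 : (2 : ℝ) ≤ N := by exact_mod_cast (by omega : 2 ≤ N)
    have hε2 : ε ≤ 1 / 2 := by nlinarith
    have hy : 4 - Real.log η ≤ κ ^ 2 / 8 * ε ^ 2 * m := by
      have h1 := CompressedSpectral.one_le_mul_log hr hrn hε hε2
      set L := (r : ℝ) / ε ^ 2 * Real.log ((n : ℝ) / (ε ^ 2 * (r : ℝ)))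
      calc 4 - Real.log η ≤ (4 - Real.log η) * (ε ^ 2 * L) :=
            le_mul_of_one_le_right (by linarith) h1
        _ = κ ^ 2 / 8 * ε ^ 2 * ((4 - Real.log η) / (κ ^ 2 / 8) * L) := by field_simp
        _ ≤ κ ^ 2 / 8 * ε ^ 2 * m := mul_le_mul_of_nonneg_left hm (by positivity)
    have hm0 : 0 < m := by
      rcases Nat.eq_zero_or_pos m with h | h
      · rw [h, Nat.cast_zero, mul_zero] at hy
        linarith
      · exact h
    set δ : ℝ := κ * (N * ε) with hδ
    have hδ0 : 0 ≤ δ := by positivity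
    have hδ1 : δ ≤ 1 := by
      rw [hδ]
      nlinarith
    refine le_trans (measure_mono ?_)
      ((CompressedSpectral.gaussianMatrix_exists_distortion_le hm0 x hδ0 hδ1).trans
        (ENNReal.ofReal_le_ofReal ?_))
    · intro Φ hΦ
      by_contra hgood
      refine hΦ fun lam' V' Q hV' hQ i => ?_
      simp only [Set.mem_ofPred_eq, not_exists, not_lt] at hgood
      have hδK : 2 * (δ * K) ≤ 1 := by
        have h1 : 0 ≤ κ * K := by positivity
        calc 2 * (δ * K) = N * ε * (2 * (κ * K)) := by rw [hδ]; ring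
          _ ≤ 1 := by nlinarith
      have htr := CompressedSpectral.trace_affinity_sub_le (by omega) hσ hK hK0.le hδ0 hδK hgood
      have hhalf : 4 * (δ * K) * Real.exp K ≤ N * ε / 2 := by
        calc 4 * (δ * K) * Real.exp K = N * ε * (4 * (κ * K) * Real.exp K) := by rw [hδ]; ring
          _ ≤ N * ε * (1 / 2) := mul_le_mul_of_nonneg_left hκK hNε.le
          _ = N * ε / 2 := by ring
      have htr2 := htr.trans (pow_le_pow_left₀ (by positivity) hhalf 2)
      have hsq : (N * ε) ^ 2 < α ^ 2 := pow_lt_pow_left₀ hcase hNε.le two_ne_zero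
      have hrow := CompressedSpectral.norm_row_sub_sq_le hk hkN hV hV' hα hgap
        (by nlinarith) hQ i
      rw [← mul_pow] at hrow
      have hle : α * ‖(WithLp.toLp 2 (CompressedSpectral.firstCols hkN.le V' i -
          CompressedSpectral.firstCols hkN.le V i ᵥ* Q) : EuclideanSpace ℝ (Fin k))‖ ≤ N * ε :=
        le_of_sq_le_sq (hrow.trans (by linarith)) hNε.le
      rw [mul_comm, ← le_div_iff₀ hα] at hle
      refine hle.trans (le_mul_of_one_le_left (by positivity) ?_)
      linarith [Real.sqrt_nonneg 2]
    · have hexp : δ ^ 2 * m / 8 = (N : ℝ) ^ 2 * (κ ^ 2 / 8 * ε ^ 2 * m) := by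
        rw [hδ]
        ring
      rw [hexp]
      exact CompressedSpectral.sq_mul_two_mul_exp_le (by omega) hη hη1 hy
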